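/- Let $q$ be a prime power, $\mathbb F_{q^m}/\mathbb F_q$ the extension of degree $m$, and let $g=(g_1,\dots,g_n)\in\mathbb F_{q^m}^n$ have entries linearly independent over $\mathbb F_q$ (so $n\le m$). Let $Gab_k(g)\subseteq\mathbb F_{q^m}^n$ be the Gabidulin code of dimension $k$, i.e. the row space over $\mathbb F_{q^m}$ of the matrix with rows $(g_1^{q^i},\dots,g_n^{q^i})$, $0\le i<k$. For $v\in\mathbb F_{q^m}^n$ let $\operatorname{rank}(v)$ be the $\mathbb F_q$-dimension of the span of its entries, and let the row space of $v$ be the row space in $\mathbb F_q^n$ of the $m\times n$ matrix obtained by expanding the entries of $v$ as columns in a basis of $\mathbb F_{q^m}$ over $\mathbb F_q$. Let $w$ be an integer with $\frac{n-k}2<w\le n-k$ and put $\xi=w-\frac{n-k}2$. For an integer $\delta\in[2\xi,n-k]$, an error-erasure decoder is a map that takes $r\in\mathbb F_{q^m}^n$ and a $\delta\times n$ matrix $B$ over $\mathbb F_q$ and returns either failure or a codeword $c\in Gab_k(g)$ within the error-erasure radius, i.e. with $2(\operatorname{rank}(r-c)-\epsilon)+\delta\le n-k$, where $\epsilon$ is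 the dimension of the intersection of the row space of $B$ with the row space of $r-c$. The column-erasure-aided randomized decoder with parameters $\delta$, $w$, $N\ge1$ works as follows on input $r$: in each of at most $N$ iterations it draws a $\delta$-dimensional subspace $U\subseteq\mathbb F_q^n$ uniformly at random (independently of everything before), calls the error-erasure decoder on $r$ and a full-rank matrix with row space $U$, and, if a codeword $c$ with $\operatorname{rank}(r-c)\le w$ is returned, outputs $c$ and stops; after $N$ unsuccessful iterations it reports failure. Every iteration is counted as $n^2$ operations over $\mathbb F_{q^m}$. Let $\binom{a}{b}_q$ be the Gaussian binomial coefficient (the number of $b$-dimensional subspaces of $\mathbb F_q^a$), and let $$\bar A_j=q^{m(k-n)}\prod_{i=0}^{j-1}\frac{(q^m-q^i)(q^n-q^i)}{q^j-q^i},\qquad P_{n,k,\delta,j}=\frac{\sum_{i=\lceil j-\frac{n-k}2+\frac\delta2\rceil}^{\min\{\delta,j\}}\binom{n-j}{\delta-i}_q\binom ji_q q^{(j-i)(\delta-i)}}{\binom n\delta_q}$$ if $2j+\delta>n-k$, and $P_{n,k,\delta,j}=1$ otherwise. Define $$\mathcal W_{RD}=\min_{\delta\in[2\xi,n-k]\cap\mathbb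 Z}\ \frac{n^2}{\sum_{j=0}^w\bar A_jP_{n,k,\delta,j}} .$$ Then $$\mathcal W_{RD}\ \ge\ \frac n{64}\,q^{\,m(n-k)-w(n+m)+w^2+\min\{2\xi(\frac{n+k}2-\xi),\,wk\}},$$ and, for $r$ uniformly distributed on $\mathbb F_{q^m}^n$, for every integer $\delta\in[2\xi,n-k]$, every error-erasure decoder and every $N\ge1$, the randomized decoder requires on average at least $\mathcal W_{RD}$ operations, hence at least the right-hand side above, per output codeword: the expected number of operations of a run divided by the probability that the run outputs a codeword (expectation and probability over $r$ and the guesses; the quotient is $+\infty$ if that probability is $0$) is at least $\mathcal W_{RD}$. -/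

import Mathlib

open scoped ENNReal

noncomputable section

namespace RankMetric

/-- The rank over `F` of a vector over `L`: the dimension of the `F`-span of its entries. -/
def rank (F : Type*) {L : Type*} [Field F] [Field L] [Algebra F L] {n : ℕ}
    (v : Fin n → L) : ℕ :=
  Module.finrank F (Submodule.span F (Set.range v))

/-- The row space in `F ^ n` of a vector `v` over `L`. Expanding the entries of `v` as columns in
a basis of `L` over `F` gives a matrix whose rows are the coordinate functionals applied
entrywise to `v`; its row space is therefore the set of all `φ ∘ v`, `φ : L → F` linear. -/
def rowSpace (F : Type*) {L : Type*} [Field F] [Field L] [Algebra F L] {n : ℕ}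
    (v : Fin n → L) : Submodule F (Fin n → F) where
  carrier := {u | ∃ φ : L →ₗ[F] F, u = fun i => φ (v i)}
  zero_mem' := ⟨0, rfl⟩
  add_mem' := by
    rintro _ _ ⟨φ, rfl⟩ ⟨ψ, rfl⟩
    exact ⟨φ + ψ, rfl⟩
  smul_mem' := by
    rintro a _ ⟨φ, rfl⟩
    exact ⟨a • φ, rfl⟩

/-- The Gabidulin code of dimension `k` with code locators `g` (to be linearly independent over
the field with `q` elements): the row space over `L` of the matrix with rows
`(g_1 ^ (q ^ i), …, g_n ^ (q ^ i))`, `0 ≤ i < k`. -/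
def gabidulin {L : Type*} [Field L] {n : ℕ} (q k : ℕ) (g : Fin n → L) :
    Submodule L (Fin n → L) :=
  Submodule.span L (Set.range fun (i : Fin k) (j : Fin n) => g j ^ q ^ (i : ℕ))

/-- The set of `δ`-dimensional subspaces of `F ^ n`. -/
abbrev Grass (F : Type*) [Field F] (n δ : ℕ) : Type _ :=
  {U : Submodule F (Fin n → F) // Module.finrank F U = δ}

instance (F : Type*) [Field F] [Fintype F] (n δ : ℕ) : Fintype (Grass F n δ) :=
  Fintype.ofFinite _

theorem grass_nonempty (F : Type*) [Field F] {n δ : ℕ} (h : δ ≤ n) :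
    Nonempty (Grass F n δ) := by
  have hli : LinearIndependent F (Pi.basisFun F (Fin n) ∘ Fin.castLE h) :=
    (Pi.basisFun F (Fin n)).linearIndependent.comp _ (Fin.castLE_injective h)
  exact ⟨⟨_, (finrank_span_eq_card hli).trans (Fintype.card_fin δ)⟩⟩

/-- A matrix of full rank with `δ` rows whose row space is `U`. -/
def basisMatrix {F : Type*} [Field F] {n δ : ℕ} (U : Grass F n δ) : Matrix (Fin δ) (Fin n) F :=
  fun i => (Module.finBasisOfFinrankEq F U.1 U.2 i : Fin n → F)

/-- A decoder taking a received word and a matrix `B` whose row space is the guess; it returns a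
word, or `none` on failure. -/
abbrev Decoder (F L : Type*) (n δ : ℕ) : Type _ :=
  (Fin n → L) → Matrix (Fin δ) (Fin n) F → Option (Fin n → L)

/-- `dec` is an error-erasure decoder for the code `C` of dimension `k`: whatever it outputs is a
codeword `c` within the error-erasure radius, `2 (rank (r - c) - ε) + δ ≤ n - k`, where `ε` is the
dimension of the intersection of the row spaces of `B` and of `r - c` (written without
subtraction). A decoder may fail; it is not required here that it succeeds on every
correctable input, so that every bound holds in particular for the decoders that do. -/
def IsErrorErasureDecoder {F L : Type*} [Field F] [Field L] [Algebra F L] {n δ : ℕ} (k : ℕ)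
    (C : Submodule L (Fin n → L)) (dec : Decoder F L n δ) : Prop :=
  ∀ (r : Fin n → L) (B : Matrix (Fin δ) (Fin n) F) (c : Fin n → L), dec r B = some c →
    c ∈ C ∧
      2 * rank F (r - c) + δ + k ≤
        n + 2 * Module.finrank F
          ↥(Submodule.span F (Set.range B) ⊓ rowSpace F (r - c))

open Classical in
/-- The randomized decoder on the received word `r`, with at most `N` iterations. An iteration
draws a uniformly random `δ`-dimensional subspace `U`, calls the decoder on `r` and a basis matrix
of `U`, and stops with the decoded word if that has rank distance at most `w` from `r`.
The result is the output (`none` for failure) together with the number of operations spent,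
where every iteration counts as `n ^ 2` operations. -/
def randomizedDecoder {F L : Type*} [Field F] [Fintype F] [Field L] [Algebra F L] {n δ : ℕ}
    (hδ : δ ≤ n) (dec : Decoder F L n δ) (w : ℕ) (r : Fin n → L) :
    ℕ → PMF (Option (Fin n → L) × ℕ)
  | 0 => PMF.pure (none, 0)
  | N + 1 =>
    haveI := grass_nonempty F hδ
    (PMF.uniformOfFintype (Grass F n δ)).bind fun U =>
      match (dec r (basisMatrix U)).filter (fun c => decide (rank F (r - c) ≤ w)) with
      | some c => PMF.pure (some c, n ^ 2)
      | none => (randomizedDecoder hδ dec w r N).map fun x => (x.1, n ^ 2 + x.2)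

/-- The randomized decoder on a uniformly random received word. -/
def randomizedDecoderOnRandomWord {F L : Type*} [Field F] [Fintype F] [Field L] [Fintype L]
    [Algebra F L] {n δ : ℕ} (hδ : δ ≤ n) (dec : Decoder F L n δ) (w N : ℕ) :
    PMF (Option (Fin n → L) × ℕ) :=
  (PMF.uniformOfFintype (Fin n → L)).bind fun r => randomizedDecoder hδ dec w r N

/-- The expected number of operations of a run. -/
def expectedOperations {α : Type*} (μ : PMF (Option α × ℕ)) : ℝ≥0∞ :=
  ∑' x, μ x * (x.2 : ℝ≥0∞)

/-- The probability that a run returns a word. -/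
def successProbability {α : Type*} (μ : PMF (Option α × ℕ)) : ℝ≥0∞ :=
  μ.toOuterMeasure {x | x.1.isSome}

/-- The average number of operations spent per word that is output: expected number of operations
over the probability of success (infinite if a positive number of operations never succeeds). -/
def averageOperations {α : Type*} (μ : PMF (Option α × ℕ)) : ℝ≥0∞ :=
  expectedOperations μ / successProbability μ

/-- The Gaussian binomial coefficient, the number of `k`-dimensional subspaces of a space of
dimension `n` over the field with `q` elements (`0` if `n < k`). -/
def gaussBinom (q n k : ℕ) : ℝ :=
  ∏ i ∈ Finset.range k, ((q : ℝ) ^ n - (q : ℝ) ^ i) / ((q : ℝ) ^ k - (q : ℝ) ^ i)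

/-- `Ā_j`. -/
def avgCount (q m n k j : ℕ) : ℝ :=
  (q : ℝ) ^ ((m : ℤ) * ((k : ℤ) - (n : ℤ))) *
    ∏ i ∈ Finset.range j,
      ((q : ℝ) ^ m - (q : ℝ) ^ i) * ((q : ℝ) ^ n - (q : ℝ) ^ i) / ((q : ℝ) ^ j - (q : ℝ) ^ i)

/-- `P_{n,k,δ,j}`. -/
def guessProb (q n k δ j : ℕ) : ℝ :=
  if 2 * j + δ + k > n then
    (∑ i ∈ Finset.Icc ⌈(j : ℝ) - ((n : ℝ) - k) / 2 + (δ : ℝ) / 2⌉₊ (min δ j),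
      gaussBinom q (n - j) (δ - i) * gaussBinom q j i * (q : ℝ) ^ ((j - i) * (δ - i))) /
        gaussBinom q n δ
  else 1

/-- `ξ = w - (n - k) / 2`. -/
def excess (n k w : ℕ) : ℝ := (w : ℝ) - ((n : ℝ) - k) / 2

/-- The work factor: the minimum of `n ^ 2 / ∑_{j ≤ w} Ā_j P_{n,k,δ,j}` over the integers
`δ ∈ [2ξ, n - k]`. -/
def workFactor (q m n k w : ℕ) : ℝ :=
  sInf ((fun δ : ℕ => (n : ℝ) ^ 2 /
      ∑ j ∈ Finset.range (w + 1), avgCount q m n k j * guessProb q n k δ j) ''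
    {δ : ℕ | 2 * excess n k w ≤ (δ : ℝ) ∧ δ + k ≤ n})

/-- `(n / 64) q ^ (m (n - k) - w (n + m) + w ^ 2 + min {2ξ ((n + k) / 2 - ξ), w k})`. -/
def workBound (q m n k w : ℕ) : ℝ :=
  (n : ℝ) / 64 *
    (q : ℝ) ^ ((m : ℝ) * ((n : ℝ) - k) - (w : ℝ) * ((n : ℝ) + m) + (w : ℝ) ^ 2 +
      min (2 * excess n k w * (((n : ℝ) + k) / 2 - excess n k w)) ((w : ℝ) * k))

end RankMetric

end

noncomputable section

namespace RankMetric

/-! ### Gaussian binomials, error counts and the guessing probability: size estimates. -/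

section GaussBinom

variable {q : ℕ}

/-! For a received word `r` let p be the probability that one iteration accepts, and let T be the
sum of (1 - p)^i over i < N, the expected number of iterations. A run costs n^2 T on average and
succeeds with probability p T, so over random `r` the quotient is n^2 E[T] / E[p T]. As T decreases
in p, Chebyshev's sum inequality gives E[p T] ≤ E[p] E[T], and the quotient is at least n^2 / E[p],
whatever N is (`ofReal_div_le_averageOperations`).

E[p] is bounded by a union bound over codewords (`mean_acceptanceProb_le`). An accepted guess U
comes with a codeword c such that e = r - c has rank at most w and U meets the row space of e in
large dimension. For fixed c the error e is uniform, and counting bases bounds the number of errors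
of rank j (`card_rank_eq_le`) and the proportion of good U (`card_goodGuesses_le`). The result is
the denominator in the work factor.

For the closed bound, Gaussian binomials are q^(k(n-k)) up to a factor 7/2. The sum in P_{n,k,δ,j}
is then bounded by a geometric series led by its first term, and the sum over j by twice the bound
for its last term (`guessProb_le`, `solutionRate_le_of_two_le`). The guess contributes the exponent
(ξ + δ/2)((n + k)/2 - δ/2), concave in δ; its values at the ends of [2ξ, n - k] form the minimum in
the statement (`min_le_half_excess_mul`). -/

theorem gaussBinom_nonneg (hq : 2 ≤ q) (n k : ℕ) : 0 ≤ gaussBinom q n k := by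
  have hq1 : (1 : ℝ) ≤ q := by exact_mod_cast (by omega : 1 ≤ q)
  rcases lt_or_ge n k with h | h
  · exact (Finset.prod_eq_zero (Finset.mem_range.2 h) (by simp)).ge
  · refine Finset.prod_nonneg fun i hi => ?_
    have hi := (Finset.mem_range.1 hi).le
    exact div_nonneg (sub_nonneg.2 (pow_le_pow_right₀ hq1 (hi.trans h)))
      (sub_nonneg.2 (pow_le_pow_right₀ hq1 hi))

theorem pow_le_gaussBinom (hq : 2 ≤ q) {n k : ℕ} (h : k ≤ n) :
    (q : ℝ) ^ (k * (n - k)) ≤ gaussBinom q n k := by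
  have hq1 : (1 : ℝ) < q := by exact_mod_cast (by omega : 1 < q)
  have : (q : ℝ) ^ (k * (n - k)) = ∏ _i ∈ Finset.range k, (q : ℝ) ^ (n - k) := by
    rw [Finset.prod_const, Finset.card_range, ← pow_mul, mul_comm]
  rw [this]
  refine Finset.prod_le_prod (fun _ _ => by positivity) fun i hi => ?_
  have hi := Finset.mem_range.1 hi
  rw [le_div_iff₀ (sub_pos.2 (pow_lt_pow_right₀ hq1 hi)), mul_sub, ← pow_add, Nat.sub_add_cancel h]
  have : (1 : ℝ) ≤ (q : ℝ) ^ (n - k) := one_le_pow₀ hq1.le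
  nlinarith [show (0 : ℝ) < (q : ℝ) ^ i by positivity]

theorem prod_one_sub_half_pow_ge (k : ℕ) :
    (2 / 7 : ℝ) ≤ ∏ i ∈ Finset.range k, (1 - (1 / 2 : ℝ) ^ (i + 1)) := by
  -- The bare bound 2/7 is not inductive, so a decaying surplus is carried along. With x =
  -- 2^(-(k+3)) ≤ 1/8, a surplus c x survives the step if c (1 - x) ≥ 1, and c = 8/7 is the least
  -- such constant.
  have key : ∀ k, (2 / 7 : ℝ) * (1 + 8 / 7 * (1 / 2) ^ (k + 3)) ≤
      ∏ i ∈ Finset.range (k + 3), (1 - (1 / 2 : ℝ) ^ (i + 1)) := by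
    intro k
    induction k with
    | zero => norm_num [Finset.prod_range_succ]
    | succ k ih =>
      rw [show k + 1 + 3 = (k + 3) + 1 by ring, Finset.prod_range_succ]
      have hx : (1 / 2 : ℝ) ^ (k + 3) ≤ 1 / 8 := by
        calc (1 / 2 : ℝ) ^ (k + 3) ≤ (1 / 2 : ℝ) ^ 3 :=
              pow_le_pow_of_le_one (by norm_num) (by norm_num) (by omega)
          _ = 1 / 8 := by norm_num
      have hx0 : 0 < (1 / 2 : ℝ) ^ (k + 3) := by positivity
      have h := mul_le_mul_of_nonneg_right ih
        (show 0 ≤ 1 - (1 / 2 : ℝ) ^ (k + 3 + 1) by rw [pow_succ]; linarith)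
      refine le_trans ?_ h
      rw [pow_succ]
      nlinarith
  rcases lt_or_ge k 3 with h | h
  · interval_cases k <;> norm_num [Finset.prod_range_succ]
  · obtain ⟨l, rfl⟩ := Nat.exists_eq_add_of_le' h
    refine le_trans ?_ (key l)
    have : 0 < (1 / 2 : ℝ) ^ (l + 3) := by positivity
    linarith

/-- The i-th factor is at most q^(n-k) / (1 - q^(i-k)), where 2 may replace q in the denominator.
The product is reversed to match the exponents k - i with those of `prod_one_sub_half_pow_ge`. -/
theorem gaussBinom_le (hq : 2 ≤ q) {n k : ℕ} (h : k ≤ n) :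
    gaussBinom q n k ≤ 7 / 2 * (q : ℝ) ^ (k * (n - k)) := by
  have hq1 : (1 : ℝ) < q := by exact_mod_cast (by omega : 1 < q)
  have hq2 : (2 : ℝ) ≤ q := by exact_mod_cast hq
  have h1 : gaussBinom q n k * ∏ i ∈ Finset.range k, (1 - (1 / 2 : ℝ) ^ (i + 1)) ≤
      (q : ℝ) ^ (k * (n - k)) := by
    rw [← Finset.prod_range_reflect, gaussBinom, ← Finset.prod_mul_distrib]
    have : (q : ℝ) ^ (k * (n - k)) = ∏ _i ∈ Finset.range k, (q : ℝ) ^ (n - k) := by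
      rw [Finset.prod_const, Finset.card_range, ← pow_mul, mul_comm]
    rw [this]
    refine Finset.prod_le_prod (fun i hi => ?_) fun i hi => ?_ <;>
      have hi := Finset.mem_range.1 hi
    · refine mul_nonneg (div_nonneg (sub_nonneg.2 (pow_le_pow_right₀ hq1.le (by omega)))
        (sub_nonneg.2 (pow_le_pow_right₀ hq1.le hi.le))) (sub_nonneg.2 (pow_le_one₀ ?_ ?_)) <;>
        norm_num
    · rw [div_mul_eq_mul_div, div_le_iff₀ (sub_pos.2 (pow_lt_pow_right₀ hq1 hi))]
      have h2 : (q : ℝ) ^ k * (1 - (1 / 2 : ℝ) ^ (k - 1 - i + 1)) ≤ (q : ℝ) ^ k - (q : ℝ) ^ i := by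
        obtain ⟨d, rfl⟩ := Nat.exists_eq_add_of_lt hi
        rw [show i + d + 1 - 1 - i + 1 = d + 1 by omega, mul_sub, mul_one, add_assoc, pow_add,
          mul_assoc, ← mul_pow]
        have : (1 : ℝ) ≤ (q * (1 / 2) : ℝ) ^ (d + 1) := one_le_pow₀ (by linarith)
        nlinarith [show (0 : ℝ) < (q : ℝ) ^ i by positivity]
      have h3 : (0 : ℝ) ≤ 1 - (1 / 2 : ℝ) ^ (k - 1 - i + 1) :=
        sub_nonneg.2 (pow_le_one₀ (by norm_num) (by norm_num))
      calc ((q : ℝ) ^ n - (q : ℝ) ^ i) * (1 - (1 / 2 : ℝ) ^ (k - 1 - i + 1))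
          ≤ (q : ℝ) ^ n * (1 - (1 / 2 : ℝ) ^ (k - 1 - i + 1)) :=
            mul_le_mul_of_nonneg_right (sub_le_self _ (by positivity)) h3
        _ = (q : ℝ) ^ (n - k) * ((q : ℝ) ^ k * (1 - (1 / 2 : ℝ) ^ (k - 1 - i + 1))) := by
            rw [← mul_assoc, ← pow_add, Nat.sub_add_cancel h]
        _ ≤ _ := mul_le_mul_of_nonneg_left h2 (by positivity)
  nlinarith [prod_one_sub_half_pow_ge k, gaussBinom_nonneg hq n k]

theorem avgCount_nonneg (hq : 2 ≤ q) {m n k j : ℕ} (hjm : j ≤ m) (hjn : j ≤ n) :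
    0 ≤ avgCount q m n k j := by
  have hq1 : (1 : ℝ) ≤ q := by exact_mod_cast (by omega : 1 ≤ q)
  refine mul_nonneg (by positivity) (Finset.prod_nonneg fun i hi => ?_)
  have hi := (Finset.mem_range.1 hi).le
  exact div_nonneg (mul_nonneg (sub_nonneg.2 (pow_le_pow_right₀ hq1 (hi.trans hjm)))
    (sub_nonneg.2 (pow_le_pow_right₀ hq1 (hi.trans hjn))))
      (sub_nonneg.2 (pow_le_pow_right₀ hq1 hi))

theorem avgCount_le (hq : 2 ≤ q) {m n k j : ℕ} (hjm : j ≤ m) (hjn : j ≤ n) :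
    avgCount q m n k j ≤ (q : ℝ) ^ ((m : ℤ) * ((k : ℤ) - (n : ℤ))) *
      (7 / 2 * (q : ℝ) ^ (j * (n + m - j))) := by
  have hq1 : (1 : ℝ) ≤ q := by exact_mod_cast (by omega : 1 ≤ q)
  refine mul_le_mul_of_nonneg_left ?_ (by positivity)
  simp_rw [mul_div_assoc]
  rw [Finset.prod_mul_distrib]
  have h1 : ∏ i ∈ Finset.range j, ((q : ℝ) ^ m - (q : ℝ) ^ i) ≤ (q : ℝ) ^ (j * m) := by
    have : (q : ℝ) ^ (j * m) = ∏ _i ∈ Finset.range j, (q : ℝ) ^ m := by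
      rw [Finset.prod_const, Finset.card_range, ← pow_mul, mul_comm]
    rw [this]
    refine Finset.prod_le_prod (fun i hi => ?_) fun i hi => sub_le_self _ (by positivity)
    exact sub_nonneg.2 (pow_le_pow_right₀ hq1 ((Finset.mem_range.1 hi).le.trans hjm))
  calc _ ≤ (q : ℝ) ^ (j * m) * (7 / 2 * (q : ℝ) ^ (j * (n - j))) :=
        mul_le_mul h1 (gaussBinom_le hq hjn) (gaussBinom_nonneg hq _ _) (by positivity)
    _ = _ := by
        rw [mul_left_comm, ← pow_add, ← mul_add, show m + (n - j) = n + m - j by omega]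

theorem guessProb_nonneg (hq : 2 ≤ q) (n k δ j : ℕ) : 0 ≤ guessProb q n k δ j := by
  unfold guessProb
  split_ifs
  · refine div_nonneg (Finset.sum_nonneg fun i _ => ?_) (gaussBinom_nonneg hq _ _)
    exact mul_nonneg (mul_nonneg (gaussBinom_nonneg hq _ _) (gaussBinom_nonneg hq _ _))
      (by positivity)
  · exact zero_le_one

theorem sum_geometric_quarter_le (a c : ℕ) :
    ∑ i ∈ Finset.Icc a c, (1 / 4 : ℝ) ^ (i - a) ≤ 4 / 3 := by
  rw [← Finset.Ico_succ_right_eq_Icc, Finset.sum_Ico_eq_sum_range]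
  simp only [Nat.add_sub_cancel_left]
  rw [geom_sum_eq (by norm_num)]
  have : (0 : ℝ) < (1 / 4 : ℝ) ^ (Order.succ c - a) := by positivity
  rw [div_le_iff_of_neg (by norm_num)]
  linarith

/-- Write i = I + d with I the least admissible intersection dimension, and b = n + I - j - δ. The
exponent of the i-th term falls short of δ (n - δ) by exactly i (b + d) ≥ I b + 2 d. So the terms
are bounded by a series of ratio 1/4, and 49/4 · 4/3 = 49/3. -/
theorem guessProb_le (hq : 2 ≤ q) {n k δ j : ℕ} (hδ : δ + k ≤ n) (hj : j ≤ n) :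
    guessProb q n k δ j ≤
      49 / 3 * ((q : ℝ) ^ ((2 * j + δ + k - n + 1) / 2 * ((n + k - δ + 1) / 2)))⁻¹ := by
  have hq2 : (2 : ℝ) ≤ q := by exact_mod_cast hq
  have hq0 : (0 : ℝ) < q := by linarith
  unfold guessProb
  split_ifs with h
  swap
  -- Below the threshold, truncated subtraction makes the exponent zero.
  · rw [show (2 * j + δ + k - n + 1) / 2 = 0 by omega]; norm_num
  set I := (2 * j + δ + k - n + 1) / 2 with hI
  set b := (n + k - δ + 1) / 2 with hb
  -- The two halved numbers have the same parity, so both are rounded alike and the relation is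
  -- exact.
  have hIb : n + I = j + δ + b := by omega
  have hI1 : 1 ≤ I := by omega
  have hG : 0 < gaussBinom q n δ :=
    lt_of_lt_of_le (by positivity) (pow_le_gaussBinom hq (by omega : δ ≤ n))
  rw [div_le_iff₀ hG]
  have hsub : Finset.Icc ⌈(j : ℝ) - ((n : ℝ) - k) / 2 + (δ : ℝ) / 2⌉₊ (min δ j) ⊆
      Finset.Icc I (min δ j) := by
    refine Finset.Icc_subset_Icc_left ?_
    have h1 := Nat.le_ceil ((j : ℝ) - ((n : ℝ) - k) / 2 + (δ : ℝ) / 2)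
    set c := ⌈(j : ℝ) - ((n : ℝ) - k) / 2 + (δ : ℝ) / 2⌉₊
    have h2 : ((2 * j + δ + k : ℕ) : ℝ) ≤ ((2 * c + n : ℕ) : ℝ) := by push_cast; linarith
    have h3 : 2 * j + δ + k ≤ 2 * c + n := by exact_mod_cast h2
    omega
  refine (Finset.sum_le_sum_of_subset_of_nonneg hsub fun i _ _ => ?_).trans ?_
  · exact mul_nonneg (mul_nonneg (gaussBinom_nonneg hq _ _) (gaussBinom_nonneg hq _ _))
      (by positivity)
  have hterm : ∀ i ∈ Finset.Icc I (min δ j),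
      gaussBinom q (n - j) (δ - i) * gaussBinom q j i * (q : ℝ) ^ ((j - i) * (δ - i)) ≤
        49 / 4 * ((q : ℝ) ^ (I * b))⁻¹ * gaussBinom q n δ * (1 / 4 : ℝ) ^ (i - I) := by
    intro i hi
    obtain ⟨hi1, hi2⟩ := Finset.mem_Icc.1 hi
    obtain ⟨hi2, hi3⟩ := le_min_iff.1 hi2
    obtain ⟨d, rfl⟩ := Nat.exists_eq_add_of_le hi1
    rw [Nat.add_sub_cancel_left]
    have e1 := gaussBinom_le hq (show δ - (I + d) ≤ n - j by omega)
    have e2 := gaussBinom_le hq hi3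
    have e3 := pow_le_gaussBinom hq (show δ ≤ n by omega)
    have hexp : I * b + 2 * d + ((δ - (I + d)) * (n - j - (δ - (I + d))) +
        ((I + d) * (j - (I + d)) + (j - (I + d)) * (δ - (I + d)))) ≤ δ * (n - δ) := by
      obtain ⟨s, hs⟩ := Nat.exists_eq_add_of_le hi2
      obtain ⟨t, ht⟩ := Nat.exists_eq_add_of_le hi3
      have hn : n - j - (δ - (I + d)) = b + d := by omega
      have hn' : n - δ = t + b + d := by omega
      rw [hn, hn', show δ - (I + d) = s by omega, show j - (I + d) = t by omega, hs]
      have : 2 * d ≤ d * (I + b + d) := by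
        rcases Nat.eq_zero_or_pos d with rfl | hd
        · simp
        · rw [mul_comm]; exact Nat.mul_le_mul_left _ (by omega)
      nlinarith
    have hpow : (q : ℝ) ^ (I * b) * 4 ^ d * ((q : ℝ) ^ ((δ - (I + d)) * (n - j - (δ - (I + d)))) *
        (q : ℝ) ^ ((I + d) * (j - (I + d))) * (q : ℝ) ^ ((j - (I + d)) * (δ - (I + d)))) ≤
        (q : ℝ) ^ (δ * (n - δ)) := by
      have h4 : (4 : ℝ) ^ d ≤ (q : ℝ) ^ (2 * d) := by
        rw [pow_mul]; exact pow_le_pow_left₀ (by norm_num) (by nlinarith) _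
      calc _ ≤ (q : ℝ) ^ (I * b) * (q : ℝ) ^ (2 * d) * ((q : ℝ) ^ ((δ - (I + d)) *
            (n - j - (δ - (I + d)))) * (q : ℝ) ^ ((I + d) * (j - (I + d))) *
              (q : ℝ) ^ ((j - (I + d)) * (δ - (I + d)))) := by gcongr
        _ = (q : ℝ) ^ (I * b + 2 * d + ((δ - (I + d)) * (n - j - (δ - (I + d))) +
            ((I + d) * (j - (I + d)) + (j - (I + d)) * (δ - (I + d))))) := by
            simp only [pow_add]; ring
        _ ≤ _ := pow_le_pow_right₀ (by linarith) hexp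
    calc _ ≤ 7 / 2 * (q : ℝ) ^ ((δ - (I + d)) * (n - j - (δ - (I + d)))) *
          (7 / 2 * (q : ℝ) ^ ((I + d) * (j - (I + d)))) *
            (q : ℝ) ^ ((j - (I + d)) * (δ - (I + d))) :=
          mul_le_mul_of_nonneg_right (mul_le_mul e1 e2 (gaussBinom_nonneg hq _ _)
            (by positivity)) (by positivity)
      _ = 49 / 4 * ((q : ℝ) ^ (I * b))⁻¹ * ((q : ℝ) ^ (I * b) * 4 ^ d *
          ((q : ℝ) ^ ((δ - (I + d)) * (n - j - (δ - (I + d)))) *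
            (q : ℝ) ^ ((I + d) * (j - (I + d))) *
              (q : ℝ) ^ ((j - (I + d)) * (δ - (I + d))))) * (1 / 4) ^ d := by
          rw [one_div, inv_pow]; field_simp; norm_num
      _ ≤ _ := by gcongr; exact hpow.trans e3
  refine (Finset.sum_le_sum hterm).trans ?_
  rw [← Finset.mul_sum]
  have := mul_le_mul_of_nonneg_left (sum_geometric_quarter_le I (min δ j))
    (show 0 ≤ 49 / 4 * ((q : ℝ) ^ (I * b))⁻¹ * gaussBinom q n δ by positivity)
  refine this.trans (le_of_eq ?_)
  ring

end GaussBinom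

/-! ### The solution rate and the closed form of the bound. -/

theorem sum_range_succ_le_two_mul {u : ℕ → ℝ} {w : ℕ} (h0 : ∀ j, 0 ≤ u j)
    (h : ∀ j < w, 2 * u j ≤ u (j + 1)) : ∑ j ∈ Finset.range (w + 1), u j ≤ 2 * u w := by
  induction w with
  | zero => simpa using by linarith [h0 0]
  | succ w ih =>
    rw [Finset.sum_range_succ]
    linarith [ih fun j hj => h j (hj.trans w.lt_succ_self), h w w.lt_succ_self]

/-- The expected number of solutions found per guess. -/
def solutionRate (q m n k δ w : ℕ) : ℝ :=
  ∑ j ∈ Finset.range (w + 1), avgCount q m n k j * guessProb q n k δ j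

theorem solutionRate_nonneg {q m n k δ w : ℕ} (hq : 2 ≤ q) (hnm : n ≤ m) (hwk : w ≤ n) :
    0 ≤ solutionRate q m n k δ w := by
  refine Finset.sum_nonneg fun j hj => ?_
  have hj := Finset.mem_range.1 hj
  exact mul_nonneg (avgCount_nonneg hq (by omega) (by omega)) (guessProb_nonneg hq _ _ _ _)

/-- Passing from j to j + 1 gains q^(n+m-2j-1) from the error count and loses at most q^b in the
guess. Since b ≤ n - w and j < w ≤ m, the net gain is at least q ≥ 2. The constants multiply to 7/2
· 49/3 · 2 = 343/3 ≤ 128 ≤ 64 n. -/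
theorem solutionRate_le_of_two_le {q m n k δ w : ℕ} (hq : 2 ≤ q) (hnm : n ≤ m) (hn : 2 ≤ n)
    (hw : 2 * w + k ≤ n + δ) (hwk : w + k ≤ n) (hδ : δ + k ≤ n) :
    solutionRate q m n k δ w ≤ 64 * n * ((q : ℝ) ^ ((m : ℤ) * ((k : ℤ) - (n : ℤ))) *
      ((q : ℝ) ^ (w * (n + m - w)) *
        ((q : ℝ) ^ ((2 * w + δ + k - n + 1) / 2 * ((n + k - δ + 1) / 2)))⁻¹)) := by
  have hq2 : (2 : ℝ) ≤ q := by exact_mod_cast hq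
  have hq0 : (0 : ℝ) < q := by linarith
  set b := (n + k - δ + 1) / 2 with hb
  set u : ℕ → ℝ := fun j => (q : ℝ) ^ (j * (n + m - j)) *
    ((q : ℝ) ^ ((2 * j + δ + k - n + 1) / 2 * b))⁻¹ with hu
  have hu0 : ∀ j, 0 ≤ u j := fun j => by positivity
  have hstep : ∀ j < w, 2 * u j ≤ u (j + 1) := by
    intro j hj
    simp only [hu]
    rw [← div_eq_mul_inv, ← div_eq_mul_inv, mul_div_assoc', div_le_div_iff₀ (by positivity)
      (by positivity)]
    calc _ ≤ (q : ℝ) ^ 1 * (q : ℝ) ^ (j * (n + m - j)) *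
          (q : ℝ) ^ ((2 * (j + 1) + δ + k - n + 1) / 2 * b) := by gcongr; simpa using hq2
      _ = (q : ℝ) ^ (1 + j * (n + m - j) + (2 * (j + 1) + δ + k - n + 1) / 2 * b) := by
          simp only [pow_add]
      _ ≤ (q : ℝ) ^ ((j + 1) * (n + m - (j + 1)) + (2 * j + δ + k - n + 1) / 2 * b) := by
          refine pow_le_pow_right₀ (by linarith) ?_
          have h1 : (2 * (j + 1) + δ + k - n + 1) / 2 * b ≤
              ((2 * j + δ + k - n + 1) / 2 + 1) * b := Nat.mul_le_mul_right _ (by omega)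
          obtain ⟨x, hx⟩ := Nat.exists_eq_add_of_le (show j + 1 ≤ n + m by omega)
          rw [show n + m - (j + 1) = x by omega, show n + m - j = x + 1 by omega]
          have h2 : b + j + 1 ≤ x := by omega
          nlinarith
      _ = _ := by simp only [pow_add]
  have hterm : ∀ j ∈ Finset.range (w + 1), avgCount q m n k j * guessProb q n k δ j ≤
      (343 / 6 * (q : ℝ) ^ ((m : ℤ) * ((k : ℤ) - (n : ℤ)))) * u j := by
    intro j hj
    have hj := Finset.mem_range.1 hj
    have := mul_le_mul (avgCount_le (k := k) hq (show j ≤ m by omega) (show j ≤ n by omega))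
      (guessProb_le hq hδ (show j ≤ n by omega)) (guessProb_nonneg hq _ _ _ _) (by positivity)
    refine this.trans (le_of_eq ?_)
    simp only [hu]; ring
  refine (Finset.sum_le_sum hterm).trans ?_
  rw [← Finset.mul_sum]
  have h1 := sum_range_succ_le_two_mul hu0 hstep
  have hn' : (2 : ℝ) ≤ n := by exact_mod_cast hn
  have hc : 0 < (q : ℝ) ^ ((m : ℤ) * ((k : ℤ) - (n : ℤ))) := by positivity
  calc _ ≤ (343 / 6 * (q : ℝ) ^ ((m : ℤ) * ((k : ℤ) - (n : ℤ)))) * (2 * u w) := by gcongr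
    _ = 343 / 3 * ((q : ℝ) ^ ((m : ℤ) * ((k : ℤ) - (n : ℤ))) * u w) := by ring
    _ ≤ 64 * n * ((q : ℝ) ^ ((m : ℤ) * ((k : ℤ) - (n : ℤ))) * u w) :=
        mul_le_mul_of_nonneg_right (by linarith) (mul_nonneg hc.le (hu0 w))

/-- The constant 64 n above needs n ≥ 2. For n = 1 the constraints force k = 0 and w = δ = 1, and
the rate is computed exactly. -/
theorem solutionRate_one {q m : ℕ} (hq : 2 ≤ q) : solutionRate q m 1 0 1 1 = 1 := by
  have hq2 : (2 : ℝ) ≤ q := by exact_mod_cast hq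
  have hq0 : (q : ℝ) ≠ 0 := by linarith
  have hq1 : (q : ℝ) - 1 ≠ 0 := by linarith
  have hm : (q : ℝ) ^ m ≠ 0 := pow_ne_zero _ hq0
  norm_num [solutionRate, Finset.sum_range_succ, avgCount, guessProb, gaussBinom, hq1, zpow_neg]
  field_simp
  ring

theorem min_le_half_excess_mul {n k w δ : ℕ} (hwk : w + k ≤ n)
    (hw : 2 * w + k ≤ n + δ) (hδ : δ + k ≤ n) (hn : n ≤ 2 * w + k) :
    min (2 * excess n k w * (((n : ℝ) + k) / 2 - excess n k w)) ((w : ℝ) * k) ≤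
      (((2 * w + δ + k - n + 1) / 2 * ((n + k - δ + 1) / 2) : ℕ) : ℝ) := by
  have h1 : 2 * (w : ℝ) + δ + k - n ≤ 2 * (((2 * w + δ + k - n + 1) / 2 : ℕ) : ℝ) := by
    have : 2 * w + δ + k ≤ 2 * ((2 * w + δ + k - n + 1) / 2) + n := by omega
    have : ((2 * w + δ + k : ℕ) : ℝ) ≤ ((2 * ((2 * w + δ + k - n + 1) / 2) + n : ℕ) : ℝ) := by
      exact_mod_cast this
    push_cast at this ⊢
    linarith
  have h2 : (n : ℝ) + k - δ ≤ 2 * (((n + k - δ + 1) / 2 : ℕ) : ℝ) := by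
    have : n + k ≤ 2 * ((n + k - δ + 1) / 2) + δ := by omega
    have : ((n + k : ℕ) : ℝ) ≤ ((2 * ((n + k - δ + 1) / 2) + δ : ℕ) : ℝ) := by
      exact_mod_cast this
    push_cast at this ⊢
    linarith
  rw [Nat.cast_mul]
  generalize (((2 * w + δ + k - n + 1) / 2 : ℕ) : ℝ) = I at *
  generalize (((n + k - δ + 1) / 2 : ℕ) : ℝ) = b at *
  have a1 : (w : ℝ) + k ≤ n := by exact_mod_cast hwk
  have a2 : 2 * (w : ℝ) + k ≤ n + δ := by exact_mod_cast hw
  have a3 : (δ : ℝ) + k ≤ n := by exact_mod_cast hδ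
  have a4 : (n : ℝ) ≤ 2 * w + k := by exact_mod_cast hn
  have a5 : (0 : ℝ) ≤ k := by positivity
  have a6 : (0 : ℝ) ≤ δ := by positivity
  have h3 : ((2 * (w : ℝ) + δ + k - n) / 2) * (((n : ℝ) + k - δ) / 2) ≤ I * b :=
    mul_le_mul (by linarith) (by linarith) (by linarith) (by linarith)
  refine le_trans ?_ h3
  unfold excess
  -- With t = δ/2, this is the slope of the secant of (ξ + t)((n + k)/2 - t) between ξ and t. Its
  -- sign decides which endpoint value lies below: t = ξ, or t = (n - k)/2 with value w k.
  rcases le_total (0 : ℝ) (((n : ℝ) + k) / 2 - δ / 2 - 2 * ((w : ℝ) - ((n : ℝ) - k) / 2)) with h | h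
  · refine (min_le_left _ _).trans ?_
    nlinarith [mul_nonneg h (show (0 : ℝ) ≤ δ / 2 - ((w : ℝ) - ((n : ℝ) - k) / 2) by linarith)]
  · refine (min_le_right _ _).trans ?_
    nlinarith [mul_nonneg (show (0 : ℝ) ≤ ((n : ℝ) - k) / 2 - δ / 2 by linarith)
      (show (0 : ℝ) ≤ -(((n : ℝ) + k) / 2 - ((w : ℝ) - ((n : ℝ) - k) / 2) - δ / 2 -
        ((n : ℝ) - k) / 2) by linarith)]

theorem workBound_le_div_solutionRate {q m n k δ w : ℕ} (hq : 2 ≤ q) (hnm : n ≤ m)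
    (hw0 : n < 2 * w + k) (hwk : w + k ≤ n) (hw : 2 * w + k ≤ n + δ) (hδ : δ + k ≤ n)
    (hS : 0 < solutionRate q m n k δ w) :
    workBound q m n k w ≤ (n : ℝ) ^ 2 / solutionRate q m n k δ w := by
  have hq2 : (2 : ℝ) ≤ q := by exact_mod_cast hq
  have hq0 : (0 : ℝ) < q := by linarith
  rcases Nat.lt_or_ge n 2 with hn | hn
  · obtain rfl : n = 1 := by omega
    obtain rfl : k = 0 := by omega
    obtain rfl : w = 1 := by omega
    obtain rfl : δ = 1 := by omega
    rw [solutionRate_one hq]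
    norm_num [workBound, excess]
  rw [le_div_iff₀ hS]
  have hmin := min_le_half_excess_mul hwk hw hδ hw0.le
  have hle := solutionRate_le_of_two_le hq hnm hn hw hwk hδ
  unfold workBound
  set M := min (2 * excess n k w * (((n : ℝ) + k) / 2 - excess n k w)) ((w : ℝ) * k)
  set Ib := (2 * w + δ + k - n + 1) / 2 * ((n + k - δ + 1) / 2)
  have hn0 : (0 : ℝ) < n := by exact_mod_cast (by omega : 0 < n)
  calc _ ≤ (n : ℝ) / 64 * (q : ℝ) ^ ((m : ℝ) * ((n : ℝ) - k) - (w : ℝ) * ((n : ℝ) + m) +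
        (w : ℝ) ^ 2 + M) * (64 * n * ((q : ℝ) ^ ((m : ℤ) * ((k : ℤ) - (n : ℤ))) *
          ((q : ℝ) ^ (w * (n + m - w)) * ((q : ℝ) ^ Ib)⁻¹))) := by gcongr
    _ = (n : ℝ) ^ 2 * ((q : ℝ) ^ ((m : ℝ) * ((n : ℝ) - k) - (w : ℝ) * ((n : ℝ) + m) +
        (w : ℝ) ^ 2 + M) * ((q : ℝ) ^ ((m : ℤ) * ((k : ℤ) - (n : ℤ))) *
          ((q : ℝ) ^ (w * (n + m - w)) * ((q : ℝ) ^ Ib)⁻¹))) := by ring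
    _ = (n : ℝ) ^ 2 * (q : ℝ) ^ (M - Ib) := by
        congr 1
        rw [← Real.rpow_intCast, ← Real.rpow_natCast (q : ℝ) (w * (n + m - w)),
          ← Real.rpow_natCast (q : ℝ) Ib, ← Real.rpow_neg hq0.le,
          ← Real.rpow_add hq0, ← Real.rpow_add hq0, ← Real.rpow_add hq0]
        congr 1
        push_cast [show w ≤ n + m by omega]
        ring
    _ ≤ (n : ℝ) ^ 2 * 1 := by
        gcongr
        exact Real.rpow_le_one_of_one_le_of_nonpos (by linarith) (by linarith)
    _ = (n : ℝ) ^ 2 := mul_one _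

/-! ### Counting subspaces and vectors of given rank through bases. -/

theorem card_mul_le_of_jointly_injective {α β : Type*} {E : α → Type*} [Finite α] [Finite β]
    (f : ∀ a, E a → β) (hf : ∀ a, Function.Injective (f a))
    (hdisj : ∀ a a' x x', f a x = f a' x' → a = a') {t : ℝ}
    (ht : ∀ a, t ≤ Nat.card (E a)) : Nat.card α * t ≤ Nat.card β := by
  have : ∀ a, Finite (E a) := fun a => Finite.of_injective _ (hf a)
  have := Fintype.ofFinite α
  have hinj : Function.Injective fun x : Σ a, E a => f x.1 x.2 := by
    rintro ⟨a, x⟩ ⟨a', x'⟩ h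
    obtain rfl : a = a' := hdisj _ _ _ _ h
    exact congrArg _ (hf a h)
  have h := Nat.card_le_card_of_injective _ hinj
  rw [Nat.card_sigma] at h
  calc (Nat.card α : ℝ) * t = ∑ _a : α, t := by
        rw [Finset.sum_const, nsmul_eq_mul, Finset.card_univ, Nat.card_eq_fintype_card]
    _ ≤ ∑ a : α, (Nat.card (E a) : ℝ) := Finset.sum_le_sum fun a _ => ht a
    _ ≤ Nat.card β := by exact_mod_cast h

section Counting

variable {F : Type*} [Field F] [Fintype F] {X : Type*} [AddCommGroup X] [Module F X] [Finite X]

theorem card_linearIndependent_real (k : ℕ) :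
    (Nat.card {s : Fin k → X // LinearIndependent F s} : ℝ) =
      ∏ i ∈ Finset.range k,
        ((Fintype.card F : ℝ) ^ Module.finrank F X - (Fintype.card F : ℝ) ^ i) := by
  rcases le_or_gt k (Module.finrank F X) with h | h
  · rw [card_linearIndependent h, Nat.cast_prod, ← Fin.prod_univ_eq_prod_range
      (fun i => (Fintype.card F : ℝ) ^ Module.finrank F X - (Fintype.card F : ℝ) ^ i)]
    refine Finset.prod_congr rfl fun i _ => ?_
    rw [Nat.cast_sub (Nat.pow_le_pow_right Fintype.card_pos (i.2.le.trans h))]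
    push_cast; rfl
  · rw [Finset.prod_eq_zero (Finset.mem_range.2 h) (sub_self _), Nat.cast_eq_zero]
    have : IsEmpty {s : Fin k → X // LinearIndependent F s} :=
      ⟨fun s => absurd s.2.fintype_card_le_finrank (by simpa using h)⟩
    exact Nat.card_of_isEmpty

/-- A family that is independent modulo `Y` amounts to an independent family in the quotient and
a family in `Y`. -/
def linearIndependentModEquiv (Y : Submodule F X) (k : ℕ) :
    {s : Fin k → X // LinearIndependent F (Y.mkQ ∘ s)} ≃
      {t : Fin k → X ⧸ Y // LinearIndependent F t} × (Fin k → Y) where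
  toFun s := (⟨Y.mkQ ∘ s.1, s.2⟩, fun i => ⟨s.1 i - Function.surjInv Y.mkQ_surjective
    (Y.mkQ (s.1 i)), by
      rw [← Submodule.Quotient.mk_eq_zero, ← Submodule.mkQ_apply, map_sub,
        Function.surjInv_eq Y.mkQ_surjective, sub_self]⟩)
  invFun t := ⟨fun i => Function.surjInv Y.mkQ_surjective (t.1.1 i) + t.2 i, by
    convert t.1.2 using 1
    ext i
    rw [Function.comp_apply, map_add, Function.surjInv_eq Y.mkQ_surjective, Submodule.mkQ_apply,
      (Submodule.Quotient.mk_eq_zero Y).2 (t.2 i).2, add_zero]⟩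
  left_inv s := by ext i; simp
  right_inv t := by
    have h : ∀ i, Y.mkQ (Function.surjInv Y.mkQ_surjective (t.1.1 i) + t.2 i) = t.1.1 i := by
      intro i
      rw [map_add, Function.surjInv_eq Y.mkQ_surjective, Submodule.mkQ_apply,
        (Submodule.Quotient.mk_eq_zero Y).2 (t.2 i).2, add_zero]
    refine Prod.ext (Subtype.ext (funext h)) (funext fun i => Subtype.ext ?_)
    simp only [h, add_sub_cancel_left]

theorem card_linearIndependent_mod (Y : Submodule F X) (k : ℕ) :
    (Nat.card {s : Fin k → X // LinearIndependent F (Y.mkQ ∘ s)} : ℝ) =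
      (∏ i ∈ Finset.range k, ((Fintype.card F : ℝ) ^ (Module.finrank F X - Module.finrank F Y) -
        (Fintype.card F : ℝ) ^ i)) * (Fintype.card F : ℝ) ^ (Module.finrank F Y * k) := by
  have : Finite (X ⧸ Y) := Finite.of_surjective _ Y.mkQ_surjective
  have h : Module.finrank F (X ⧸ Y) = Module.finrank F X - Module.finrank F Y := by
    rw [← Y.finrank_quotient_add_finrank, Nat.add_sub_cancel]
  rw [Nat.card_congr (linearIndependentModEquiv Y k), Nat.card_prod, Nat.cast_mul,
    card_linearIndependent_real, h, Nat.card_fun, Nat.card_eq_fintype_card (α := Fin k),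
    Fintype.card_fin, Module.natCard_eq_pow_finrank (K := F) (V := Y), Nat.card_eq_fintype_card,
    ← pow_mul, Nat.cast_pow]

theorem prod_pow_sub_pow_pos {q : ℕ} (hq : 2 ≤ q) (k : ℕ) :
    0 < ∏ i ∈ Finset.range k, ((q : ℝ) ^ k - (q : ℝ) ^ i) := by
  have hq1 : (1 : ℝ) < q := by exact_mod_cast (by omega : 1 < q)
  exact Finset.prod_pos fun i hi => sub_pos.2 (pow_lt_pow_right₀ hq1 (Finset.mem_range.1 hi))

theorem gaussBinom_mul_prod {q : ℕ} (hq : 2 ≤ q) (n k : ℕ) :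
    gaussBinom q n k * ∏ i ∈ Finset.range k, ((q : ℝ) ^ k - (q : ℝ) ^ i) =
      ∏ i ∈ Finset.range k, ((q : ℝ) ^ n - (q : ℝ) ^ i) := by
  rw [gaussBinom, Finset.prod_div_distrib, div_mul_cancel₀ _ (prod_pow_sub_pow_pos hq k).ne']

/-- Every independent family is an ordered basis of its span. A lower bound suffices, since the
number of guesses stands in a denominator. -/
theorem gaussBinom_le_card_grass (n δ : ℕ) :
    gaussBinom (Fintype.card F) n δ ≤ Fintype.card (Grass F n δ) := by
  have hq : 2 ≤ Fintype.card F := Fintype.one_lt_card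
  refine le_of_mul_le_mul_right ?_ (prod_pow_sub_pow_pos hq δ)
  rw [gaussBinom_mul_prod hq]
  let f : {s : Fin δ → (Fin n → F) // LinearIndependent F s} →
      Σ U : Grass F n δ, {s : Fin δ → U.1 // LinearIndependent F s} := fun s =>
    ⟨⟨Submodule.span F (Set.range s.1), (finrank_span_eq_card s.2).trans (Fintype.card_fin δ)⟩,
      fun i => ⟨s.1 i, Submodule.subset_span ⟨i, rfl⟩⟩, linearIndependent_span s.2⟩
  have hf : Function.Injective f := by
    intro s s' h
    have := congrArg (fun t : Σ U : Grass F n δ,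
      {s : Fin δ → U.1 // LinearIndependent F s} => fun i => (t.2.1 i : Fin n → F)) h
    exact Subtype.ext this
  have h := Nat.card_le_card_of_injective f hf
  rw [Nat.card_sigma] at h
  have h' : (Nat.card {s : Fin δ → (Fin n → F) // LinearIndependent F s} : ℝ) ≤
      ∑ U : Grass F n δ, (Nat.card {s : Fin δ → U.1 // LinearIndependent F s} : ℝ) := by
    exact_mod_cast h
  simp_rw [card_linearIndependent_real, fun U : Grass F n δ => U.2] at h'
  rwa [Module.finrank_fin_fun, Finset.sum_const, nsmul_eq_mul, Finset.card_univ] at h'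

omit [Fintype F] [Finite X] in
theorem linearIndependent_comap_coe {W V : Submodule F X} {ι : Type*}
    {a : ι → V.comap W.subtype} (ha : LinearIndependent F a) :
    LinearIndependent F fun l => (⟨(a l : W), (a l).2⟩ : V) := by
  refine LinearIndependent.of_comp V.subtype ?_
  have h1 := ha.map' (V.comap W.subtype).subtype (Submodule.ker_subtype _)
  exact h1.map' W.subtype (Submodule.ker_subtype _)

omit [Fintype F] [Finite X] in
-- W / (V ⊓ W) embeds in X / V.
theorem linearIndependent_mkQ_coe {W V : Submodule F X} {ι : Type*} {c : ι → W}
    (hc : LinearIndependent F ((V.comap W.subtype).mkQ ∘ c)) :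
    LinearIndependent F (V.mkQ ∘ fun l => (c l : X)) := by
  have hker : LinearMap.ker ((V.comap W.subtype).mapQ V W.subtype le_rfl) = ⊥ := by
    rw [Submodule.mapQ, Submodule.ker_liftQ, LinearMap.ker_comp, Submodule.ker_mkQ,
      Submodule.mkQ_map_self]
  exact hc.map' _ hker

/-- A basis of U ⊓ V, together with δ - i vectors of U independent modulo U ⊓ V, spans U; its halves
are an independent family in V and a family independent modulo V. Lifting from the quotient leaves
q^(dim V) choices per vector in F^n but q^i in U, whence the extra power of q. -/
theorem card_grass_inf_le {n δ i : ℕ} (V : Submodule F (Fin n → F)) (hi : i ≤ δ)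
    (hiV : i ≤ Module.finrank F V) :
    (Nat.card {U : Grass F n δ // Module.finrank F ↥(U.1 ⊓ V) = i} : ℝ) ≤
      gaussBinom (Fintype.card F) (n - Module.finrank F V) (δ - i) *
        gaussBinom (Fintype.card F) (Module.finrank F V) i *
          (Fintype.card F : ℝ) ^ ((Module.finrank F V - i) * (δ - i)) := by
  have hq : 2 ≤ Fintype.card F := Fintype.one_lt_card
  have hY : ∀ U : {U : Grass F n δ // Module.finrank F ↥(U.1 ⊓ V) = i},
      Module.finrank F (V.comap U.1.1.subtype) = i := fun U => by
    refine Eq.trans ?_ U.2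
    rw [← Submodule.map_comap_subtype, Submodule.finrank_map_subtype_eq]
  have hex : ∀ U : {U : Grass F n δ // Module.finrank F ↥(U.1 ⊓ V) = i},
      ∃ f : ({a : Fin i → V.comap U.1.1.subtype // LinearIndependent F a} ×
        {c : Fin (δ - i) → U.1.1 // LinearIndependent F ((V.comap U.1.1.subtype).mkQ ∘ c)}) →
        ({a : Fin i → V // LinearIndependent F a} ×
        {c : Fin (δ - i) → (Fin n → F) // LinearIndependent F (V.mkQ ∘ c)}),
      Function.Injective f ∧ ∀ x, Submodule.span F (Set.range
        (Sum.elim (fun l => ((f x).1.1 l : Fin n → F)) (f x).2.1)) = U.1.1 := by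
    intro U
    refine ⟨fun x => (⟨_, linearIndependent_comap_coe x.1.2⟩,
      ⟨_, linearIndependent_mkQ_coe x.2.2⟩), ?_, ?_⟩
    · rintro ⟨a, c⟩ ⟨a', c'⟩ h
      have h1 := congrArg (fun y => y.1.1) h
      have h2 := congrArg (fun y => y.2.1) h
      refine Prod.ext (Subtype.ext (funext fun l => ?_)) (Subtype.ext (funext fun l => ?_))
      · exact Subtype.ext (Subtype.ext
          (congrArg (fun v : V => (v : Fin n → F)) (congrFun h1 l)))
      · exact Subtype.ext (congrFun h2 l)
    · rintro ⟨a, c⟩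
      refine Submodule.eq_of_le_of_finrank_eq ?_ ?_
      · rw [Submodule.span_le]
        rintro _ ⟨l | l, rfl⟩
        exacts [(a.1 l).1.2, (c.1 l).2]
      · rw [finrank_span_eq_card ((linearIndependent_comap_coe a.2).sumElim_of_quotient _
          (linearIndependent_mkQ_coe c.2)), U.1.2]
        simp [hi]
  choose f hf hspan using hex
  have key := card_mul_le_of_jointly_injective f hf
    (fun U U' x x' h => Subtype.ext (Subtype.ext (by rw [← hspan U x, h, hspan U' x'])))
    (t := (∏ l ∈ Finset.range i, ((Fintype.card F : ℝ) ^ i - (Fintype.card F : ℝ) ^ l)) *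
      ((∏ l ∈ Finset.range (δ - i), ((Fintype.card F : ℝ) ^ (δ - i) - (Fintype.card F : ℝ) ^ l)) *
        (Fintype.card F : ℝ) ^ (i * (δ - i))))
    (fun U => by
      have h1 := card_linearIndependent_real (F := F) (X := V.comap U.1.1.subtype) i
      have h2 := card_linearIndependent_mod (V.comap U.1.1.subtype) (δ - i)
      rw [hY] at h1
      rw [hY, U.1.2] at h2
      rw [Nat.card_prod, Nat.cast_mul, h1, h2])
  rw [Nat.card_prod, Nat.cast_mul, card_linearIndependent_real, card_linearIndependent_mod,
    Module.finrank_fin_fun, ← gaussBinom_mul_prod hq (n - Module.finrank F V) (δ - i),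
    ← gaussBinom_mul_prod hq (Module.finrank F V) i] at key
  have hpos := prod_pow_sub_pow_pos hq i
  have hpos' := prod_pow_sub_pow_pos hq (δ - i)
  set A := ∏ l ∈ Finset.range i, ((Fintype.card F : ℝ) ^ i - (Fintype.card F : ℝ) ^ l)
  set B := ∏ l ∈ Finset.range (δ - i), ((Fintype.card F : ℝ) ^ (δ - i) - (Fintype.card F : ℝ) ^ l)
  have hF : (0 : ℝ) < Fintype.card F := by exact_mod_cast Fintype.card_pos
  refine le_of_mul_le_mul_right (key.trans (le_of_eq ?_)) (by positivity :
    0 < A * (B * (Fintype.card F : ℝ) ^ (i * (δ - i))))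
  obtain ⟨d, hd⟩ := Nat.exists_eq_add_of_le hiV
  rw [hd, Nat.add_sub_cancel_left, add_mul, pow_add]
  ring

omit [Fintype F] in
-- The row space is the range of the dual of the map F^n → L given by `v`, so this is equality of
-- row and column rank.
theorem finrank_rowSpace {L : Type*} [Field L] [Finite L] [Algebra F L] {n : ℕ} (v : Fin n → L) :
    Module.finrank F (rowSpace F v) = rank F v := by
  have h : rowSpace F v = (LinearMap.range (Fintype.linearCombination F v).dualMap).map
      ((Pi.basisFun F (Fin n)).constr F).symm.toLinearMap := by
    ext u
    simp only [Submodule.mem_map, LinearMap.mem_range, exists_exists_eq_and]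
    refine exists_congr fun φ => ?_
    rw [eq_comm]
    refine Eq.congr ?_ rfl
    ext i
    simp [Module.Basis.constr_symm_apply]
  rw [h, LinearEquiv.finrank_map_eq, LinearMap.finrank_range_dualMap_eq_finrank_range,
    Fintype.range_linearCombination]
  rfl

/-- There are at most as many vectors of rank `j` as matrices of rank `j`. -/
theorem card_rank_eq_le {L : Type*} [Field L] [Finite L] [Algebra F L] (n j : ℕ) :
    (Nat.card {v : Fin n → L // rank F v = j} : ℝ) ≤
      ∏ i ∈ Finset.range j,
        ((Fintype.card F : ℝ) ^ Module.finrank F L - (Fintype.card F : ℝ) ^ i) *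
          ((Fintype.card F : ℝ) ^ n - (Fintype.card F : ℝ) ^ i) /
            ((Fintype.card F : ℝ) ^ j - (Fintype.card F : ℝ) ^ i) := by
  have hq : 2 ≤ Fintype.card F := Fintype.one_lt_card
  rw [Finset.prod_div_distrib, Finset.prod_mul_distrib, le_div_iff₀ (prod_pow_sub_pow_pos hq j)]
  let b (v : {v : Fin n → L // rank F v = j})
      (s : {s : Fin j → Submodule.span F (Set.range v.1) // LinearIndependent F s}) :
      Module.Basis (Fin j) F (Submodule.span F (Set.range v.1)) :=
    basisOfLinearIndependentOfCardEqFinrank' s.1 s.2 ((Fintype.card_fin j).trans v.2.symm)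
  have hb : ∀ v s l, b v s l = s.1 l := by simp [b]
  let M (v : {v : Fin n → L // rank F v = j})
      (s : {s : Fin j → Submodule.span F (Set.range v.1) // LinearIndependent F s}) :
      Fin j → Fin n → F := fun l i => (b v s).coord l ⟨v.1 i, Submodule.subset_span ⟨i, rfl⟩⟩
  have hM : ∀ v s, LinearIndependent F (M v s) := by
    intro v s
    rw [Fintype.linearIndependent_iff]
    intro c hc l
    -- A relation between the rows is a combination of coordinate functionals that kills the entries
    -- of `v`, hence their span; its value at the l-th basis vector is c l.
    have h0 : ∀ x : Submodule.span F (Set.range v.1), (∑ l, c l • (b v s).coord l) x = 0 := by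
      rintro ⟨x, hx⟩
      induction hx using Submodule.span_induction with
      | mem x h =>
        obtain ⟨i, rfl⟩ := h
        simpa [M] using congrFun hc i
      | zero => exact map_zero _
      | add x y hx hy h1 h2 =>
        have := map_add (∑ l, c l • (b v s).coord l) ⟨x, hx⟩ ⟨y, hy⟩
        rw [h1, h2, add_zero] at this
        exact this
      | smul a x hx h1 =>
        have := map_smul (∑ l, c l • (b v s).coord l) a ⟨x, hx⟩
        rw [h1, smul_zero] at this
        exact this
    simpa [Finsupp.single_apply] using h0 (b v s l)
  have hv : ∀ v s i, v.1 i = ∑ l, M v s l i • (s.1 l : L) := by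
    intro v s i
    have := congrArg Subtype.val
      ((b v s).sum_repr ⟨v.1 i, Submodule.subset_span ⟨i, rfl⟩⟩)
    simpa [hb, M] using this.symm
  have key := card_mul_le_of_jointly_injective
    (α := {v : Fin n → L // rank F v = j})
    (β := {s : Fin j → L // LinearIndependent F s} ×
      {s : Fin j → Fin n → F // LinearIndependent F s})
    (E := fun v => {s : Fin j → Submodule.span F (Set.range v.1) // LinearIndependent F s})
    (fun v s => (⟨fun l => s.1 l, s.2.map' _ (Submodule.ker_subtype _)⟩, ⟨M v s, hM v s⟩))
    (by
      intro v s s' h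
      have h1 := congrArg (fun y => y.1.1) h
      exact Subtype.ext (funext fun l => Subtype.ext (congrFun h1 l)))
    (by
      intro v v' s s' h
      have h1 : ∀ l, (s.1 l : L) = s'.1 l := congrFun (congrArg (fun y => y.1.1) h)
      have h2 : M v s = M v' s' := congrArg (fun y => y.2.1) h
      refine Subtype.ext (funext fun i => ?_)
      rw [hv v s i, hv v' s' i]
      exact Finset.sum_congr rfl fun l _ => by rw [h1 l, h2])
    (t := ∏ i ∈ Finset.range j, ((Fintype.card F : ℝ) ^ j - (Fintype.card F : ℝ) ^ i))
    (fun v => by 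
      rw [card_linearIndependent_real, show Module.finrank F
        (Submodule.span F (Set.range v.1)) = j from v.2])
  rwa [Nat.card_prod, Nat.cast_mul, card_linearIndependent_real, card_linearIndependent_real,
    Module.finrank_fin_fun] at key

end Counting

/-! ### Expected cost and success probability of composed random experiments. -/

theorem tsum_uniformOfFintype_mul_ofReal {α : Type*} [Fintype α] [Nonempty α] {f : α → ℝ}
    (hf : ∀ a, 0 ≤ f a) :
    ∑' a, PMF.uniformOfFintype α a * ENNReal.ofReal (f a) =
      ENNReal.ofReal ((∑ a, f a) / Fintype.card α) := by
  rw [tsum_fintype, ENNReal.ofReal_div_of_pos (by exact_mod_cast Fintype.card_pos),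
    ENNReal.ofReal_sum_of_nonneg fun a _ => hf a, ENNReal.ofReal_natCast, ENNReal.div_eq_inv_mul,
    Finset.mul_sum]
  simp

section Cost

variable {α β : Type*}

theorem expectedOperations_pure (x : Option α × ℕ) :
    expectedOperations (PMF.pure x) = (x.2 : ℝ≥0∞) := by
  classical
  rw [expectedOperations, tsum_eq_single x fun y hy => by rw [PMF.pure_apply_of_ne _ _ hy, zero_mul],
    PMF.pure_apply_self, one_mul]

theorem expectedOperations_bind (μ : PMF β) (f : β → PMF (Option α × ℕ)) :
    expectedOperations (μ.bind f) = ∑' b, μ b * expectedOperations (f b) := by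
  simp_rw [expectedOperations, PMF.bind_apply, ← ENNReal.tsum_mul_right, ← ENNReal.tsum_mul_left]
  rw [ENNReal.tsum_comm]
  simp_rw [mul_assoc]

theorem expectedOperations_map_add (μ : PMF (Option α × ℕ)) (c : ℕ) :
    expectedOperations (μ.map fun x => (x.1, c + x.2)) = c + expectedOperations μ := by
  rw [PMF.map, expectedOperations_bind]
  simp only [Function.comp_apply, expectedOperations_pure, Nat.cast_add, mul_add]
  rw [ENNReal.tsum_add, ENNReal.tsum_mul_right, PMF.tsum_coe, one_mul, expectedOperations]

theorem successProbability_bind (μ : PMF β) (f : β → PMF (Option α × ℕ)) :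
    successProbability (μ.bind f) = ∑' b, μ b * successProbability (f b) :=
  PMF.toOuterMeasure_bind_apply _ _ _

theorem successProbability_pure_some (a : α) (c : ℕ) :
    successProbability (PMF.pure (some a, c)) = 1 := by
  simp [successProbability, PMF.toOuterMeasure_pure_apply]

theorem successProbability_pure_none (c : ℕ) :
    successProbability (PMF.pure ((none : Option α), c)) = 0 := by
  simp [successProbability, PMF.toOuterMeasure_pure_apply]

theorem successProbability_map_add (μ : PMF (Option α × ℕ)) (c : ℕ) :
    successProbability (μ.map fun x => (x.1, c + x.2)) = successProbability μ := by
  rw [successProbability, PMF.toOuterMeasure_map_apply]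
  rfl

end Cost

/-! ### Runs of the randomized decoder and Chebyshev's inequality. -/

section Decoder

variable {F L : Type*} [Field F] [Fintype F] [Field L] [Algebra F L] {n δ : ℕ}

open Classical in
/-- The guesses on which an iteration of the randomized decoder on `r` stops. -/
def acceptedGuesses (dec : Decoder F L n δ) (w : ℕ) (r : Fin n → L) : Finset (Grass F n δ) :=
  {U | ((dec r (basisMatrix U)).filter (fun c => decide (rank F (r - c) ≤ w))).isSome}

/-- The probability that an iteration of the randomized decoder on `r` stops. -/
def acceptanceProb (dec : Decoder F L n δ) (w : ℕ) (r : Fin n → L) : ℝ :=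
  ((acceptedGuesses dec w r).card : ℝ) / Fintype.card (Grass F n δ)

theorem acceptanceProb_nonneg (dec : Decoder F L n δ) (w : ℕ) (r : Fin n → L) :
    0 ≤ acceptanceProb dec w r := by
  unfold acceptanceProb; positivity

theorem acceptanceProb_le_one (dec : Decoder F L n δ) (w : ℕ) (r : Fin n → L) :
    acceptanceProb dec w r ≤ 1 :=
  div_le_one_of_le₀ (by exact_mod_cast Finset.card_le_univ _) (by positivity)

/-- The expected number of iterations of the randomized decoder on `r`. -/
def expectedIterations (dec : Decoder F L n δ) (w N : ℕ) (r : Fin n → L) : ℝ :=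
  ∑ i ∈ Finset.range N, (1 - acceptanceProb dec w r) ^ i

theorem expectedIterations_succ (dec : Decoder F L n δ) (w N : ℕ) (r : Fin n → L) :
    expectedIterations dec w (N + 1) r =
      1 + (1 - acceptanceProb dec w r) * expectedIterations dec w N r := by
  rw [expectedIterations, Finset.sum_range_succ', expectedIterations, Finset.mul_sum, add_comm]
  simp [pow_succ']

theorem expectedIterations_nonneg (dec : Decoder F L n δ) (w N : ℕ) (r : Fin n → L) :
    0 ≤ expectedIterations dec w N r :=
  Finset.sum_nonneg fun _ _ => pow_nonneg (sub_nonneg.2 (acceptanceProb_le_one dec w r)) _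

theorem one_le_expectedIterations (dec : Decoder F L n δ) (w : ℕ) {N : ℕ} (hN : 1 ≤ N)
    (r : Fin n → L) : 1 ≤ expectedIterations dec w N r := by
  obtain ⟨N, rfl⟩ := Nat.exists_eq_add_of_le' hN
  rw [expectedIterations_succ]
  nlinarith [expectedIterations_nonneg dec w N r, acceptanceProb_le_one dec w r]

theorem sum_ite_acceptedGuesses_div (hδ : δ ≤ n) (dec : Decoder F L n δ) (w : ℕ) (r : Fin n → L)
    (a b : ℝ) [DecidablePred (· ∈ acceptedGuesses dec w r)] :
    (∑ U, if U ∈ acceptedGuesses dec w r then a else b) / Fintype.card (Grass F n δ) =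
      acceptanceProb dec w r * a + (1 - acceptanceProb dec w r) * b := by
  have := grass_nonempty F hδ
  have hG : (Fintype.card (Grass F n δ) : ℝ) ≠ 0 := by exact_mod_cast Fintype.card_ne_zero
  have h : ∀ U, (if U ∈ acceptedGuesses dec w r then a else b) =
      b + if U ∈ acceptedGuesses dec w r then a - b else 0 := fun U => by split_ifs <;> ring
  simp_rw [h]
  rw [Finset.sum_add_distrib, Finset.sum_const, ← Finset.sum_filter, Finset.sum_const,
    show Finset.univ.filter (· ∈ acceptedGuesses dec w r) = acceptedGuesses dec w r by ext; simp,
    nsmul_eq_mul, nsmul_eq_mul, Finset.card_univ, acceptanceProb]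
  field_simp
  ring

theorem expectedOperations_randomizedDecoder (hδ : δ ≤ n) (dec : Decoder F L n δ) (w : ℕ)
    (r : Fin n → L) (N : ℕ) :
    expectedOperations (randomizedDecoder hδ dec w r N) =
      ENNReal.ofReal ((n : ℝ) ^ 2 * expectedIterations dec w N r) := by
  classical
  have := grass_nonempty F hδ
  induction N with
  | zero => simp [randomizedDecoder, expectedOperations_pure, expectedIterations]
  | succ N ih =>
    have hE := expectedIterations_nonneg dec w N r
    rw [randomizedDecoder, expectedOperations_bind]
    refine (tsum_congr fun U => congrArg (PMF.uniformOfFintype _ U * ·)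
      (?_ : _ = ENNReal.ofReal (if U ∈ acceptedGuesses dec w r then (n : ℝ) ^ 2 else
          (n : ℝ) ^ 2 + (n : ℝ) ^ 2 * expectedIterations dec w N r))).trans ?_
    · simp only [acceptedGuesses, Finset.mem_filter_univ]
      cases (dec r (basisMatrix U)).filter (fun c => decide (rank F (r - c) ≤ w)) with
      | some c =>
        simp only [expectedOperations_pure, Option.isSome_some, if_true]
        rw [← Nat.cast_pow, ENNReal.ofReal_natCast]
      | none =>
        simp only [expectedOperations_map_add, ih, Option.isSome_none, Bool.false_eq_true, if_false]
        rw [ENNReal.ofReal_add (by positivity) (by positivity), ← Nat.cast_pow,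
          ENNReal.ofReal_natCast]
    rw [tsum_uniformOfFintype_mul_ofReal fun U => by split_ifs <;> positivity,
      sum_ite_acceptedGuesses_div hδ, expectedIterations_succ]
    congr 1
    ring

/-- A run stops successfully at iteration i with probability p (1 - p)^i. -/
theorem successProbability_randomizedDecoder (hδ : δ ≤ n) (dec : Decoder F L n δ) (w : ℕ)
    (r : Fin n → L) (N : ℕ) :
    successProbability (randomizedDecoder hδ dec w r N) =
      ENNReal.ofReal (acceptanceProb dec w r * expectedIterations dec w N r) := by
  classical
  have := grass_nonempty F hδ
  induction N with
  | zero => simp [randomizedDecoder, successProbability_pure_none, expectedIterations]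
  | succ N ih =>
    have hE := expectedIterations_nonneg dec w N r
    have hA := acceptanceProb_nonneg dec w r
    rw [randomizedDecoder, successProbability_bind]
    refine (tsum_congr fun U => congrArg (PMF.uniformOfFintype _ U * ·)
      (?_ : _ = ENNReal.ofReal (if U ∈ acceptedGuesses dec w r then 1 else
          acceptanceProb dec w r * expectedIterations dec w N r))).trans ?_
    · simp only [acceptedGuesses, Finset.mem_filter_univ]
      cases (dec r (basisMatrix U)).filter (fun c => decide (rank F (r - c) ≤ w)) with
      | some c => simp only [successProbability_pure_some, Option.isSome_some, if_true,
          ENNReal.ofReal_one]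
      | none =>
        simp only [successProbability_map_add, ih, Option.isSome_none, Bool.false_eq_true, if_false]
    rw [tsum_uniformOfFintype_mul_ofReal fun U => by split_ifs <;> positivity,
      sum_ite_acceptedGuesses_div hδ, expectedIterations_succ]
    congr 1
    ring

theorem antivary_acceptanceProb_expectedIterations (dec : Decoder F L n δ) (w N : ℕ) :
    Antivary (acceptanceProb dec w) (expectedIterations dec w N) := by
  intro r s h
  by_contra! hlt
  refine h.not_ge (Finset.sum_le_sum fun i _ => ?_)
  exact pow_le_pow_left₀ (sub_nonneg.2 (acceptanceProb_le_one dec w s)) (by linarith) _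

theorem ofReal_div_le_averageOperations [Fintype L] (hn : 0 < n) (hδ : δ ≤ n)
    (dec : Decoder F L n δ) (w : ℕ) {N : ℕ} (hN : 1 ≤ N) {S : ℝ} (hS0 : 0 ≤ S)
    (hS : (∑ r, acceptanceProb dec w r) / Fintype.card (Fin n → L) ≤ S) :
    ENNReal.ofReal ((n : ℝ) ^ 2 / S) ≤
      averageOperations (randomizedDecoderOnRandomWord hδ dec w N) := by
  -- For S = 0 real division yields 0 on the left.
  rcases hS0.eq_or_lt with rfl | hS0
  · simp
  have hR : (0 : ℝ) < Fintype.card (Fin n → L) := by exact_mod_cast Fintype.card_pos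
  have hn' : (0 : ℝ) < n := by exact_mod_cast hn
  -- With `N ≥ 1` the expected cost is positive, so a vanishing success probability gives ∞ and not
  -- 0 / 0.
  have hpos : 0 < ∑ r : Fin n → L, expectedIterations dec w N r :=
    Finset.sum_pos (fun r _ => one_pos.trans_le (one_le_expectedIterations dec w hN r))
      Finset.univ_nonempty
  rw [averageOperations, randomizedDecoderOnRandomWord, expectedOperations_bind,
    successProbability_bind]
  simp_rw [expectedOperations_randomizedDecoder, successProbability_randomizedDecoder]
  rw [tsum_uniformOfFintype_mul_ofReal fun r =>
      mul_nonneg (by positivity) (expectedIterations_nonneg dec w N r),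
    tsum_uniformOfFintype_mul_ofReal fun r =>
      mul_nonneg (acceptanceProb_nonneg dec w r) (expectedIterations_nonneg dec w N r),
    ← Finset.mul_sum, ENNReal.le_div_iff_mul_le
      (Or.inr (ENNReal.ofReal_pos.2 (by positivity)).ne') (Or.inl ENNReal.ofReal_ne_top),
    ← ENNReal.ofReal_mul (by positivity)]
  refine ENNReal.ofReal_le_ofReal ?_
  have hC := ((antivary_acceptanceProb_expectedIterations dec w N).antivaryOn
    (Finset.univ : Finset (Fin n → L))).card_mul_sum_le_sum_mul_sum
  rw [Finset.card_univ] at hC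
  rw [div_le_iff₀ hR] at hS
  have h1 := hC.trans (mul_le_mul_of_nonneg_right hS hpos.le)
  have h2 : ∑ r : Fin n → L, acceptanceProb dec w r * expectedIterations dec w N r ≤
      S * ∑ r : Fin n → L, expectedIterations dec w N r :=
    le_of_mul_le_mul_left (by linarith) hR
  rw [div_mul_div_comm, div_le_div_iff₀ (by positivity) hR]
  have : 0 ≤ (n : ℝ) ^ 2 * Fintype.card (Fin n → L) := by positivity
  nlinarith [mul_le_mul_of_nonneg_left h2 this]

end Decoder

/-! ### Mean acceptance probability by a union bound over codewords. -/

section Guess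

variable {F L : Type*} [Field F] [Fintype F] [Field L] [Fintype L] [Algebra F L] {n δ : ℕ}

omit [Fintype F] in
theorem span_range_basisMatrix (U : Grass F n δ) :
    Submodule.span F (Set.range (basisMatrix U)) = U.1 := by
  have h : Set.range (basisMatrix U) =
      U.1.subtype '' Set.range (Module.finBasisOfFinrankEq F U.1 U.2) := by
    rw [← Set.range_comp]; rfl
  rw [h, ← Submodule.map_span, Module.Basis.span_eq, Submodule.map_top, Submodule.range_subtype]

open Classical in
/-- The guesses for which an error with row space `V` lies within the error-erasure radius. -/
def goodGuesses (k δ : ℕ) (V : Submodule F (Fin n → F)) : Finset (Grass F n δ) :=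
  {U | 2 * Module.finrank F V + δ + k ≤ n + 2 * Module.finrank F ↥(U.1 ⊓ V)}

/-- Sort the good guesses by i = dim (U ⊓ V): goodness is i ≥ j - (n - k)/2 + δ/2, the lower limit
of the sum. -/
theorem card_goodGuesses_le (hδ : δ ≤ n) (k : ℕ) (V : Submodule F (Fin n → F)) :
    ((goodGuesses k δ V).card : ℝ) ≤ Fintype.card (Grass F n δ) *
      guessProb (Fintype.card F) n k δ (Module.finrank F V) := by
  classical
  have hq : 2 ≤ Fintype.card F := Fintype.one_lt_card
  have hq0 : (0 : ℝ) < Fintype.card F := by exact_mod_cast Fintype.card_pos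
  unfold guessProb
  split_ifs with h
  swap
  · rw [mul_one]; exact_mod_cast Finset.card_le_univ _
  set j := Module.finrank F V
  set I := Finset.Icc ⌈(j : ℝ) - ((n : ℝ) - k) / 2 + (δ : ℝ) / 2⌉₊ (min δ j)
  have hmaps : ∀ U ∈ goodGuesses k δ V, Module.finrank F ↥(U.1 ⊓ V) ∈ I := by
    intro U hU
    replace hU : 2 * j + δ + k ≤ n + 2 * Module.finrank F ↥(U.1 ⊓ V) := by
      simpa [goodGuesses] using hU
    refine Finset.mem_Icc.2 ⟨Nat.ceil_le.2 ?_, le_min ?_ (Submodule.finrank_mono inf_le_right)⟩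
    · have : 2 * (j : ℝ) + δ + k ≤ n + 2 * (Module.finrank F ↥(U.1 ⊓ V) : ℝ) := by
        exact_mod_cast hU
      linarith
    · exact (Submodule.finrank_mono inf_le_left).trans U.2.le
  have hG : gaussBinom (Fintype.card F) n δ ≤ Fintype.card (Grass F n δ) :=
    gaussBinom_le_card_grass n δ
  have hG0 : 0 < gaussBinom (Fintype.card F) n δ :=
    lt_of_lt_of_le (by positivity) (pow_le_gaussBinom hq hδ)
  set S := ∑ i ∈ I, gaussBinom (Fintype.card F) (n - j) (δ - i) *
    gaussBinom (Fintype.card F) j i * (Fintype.card F : ℝ) ^ ((j - i) * (δ - i))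
  have hS : ((goodGuesses k δ V).card : ℝ) ≤ S := by
    rw [Finset.card_eq_sum_card_fiberwise hmaps, Nat.cast_sum]
    refine Finset.sum_le_sum fun i hi => ?_
    obtain ⟨-, hi⟩ := Finset.mem_Icc.1 hi
    obtain ⟨hi1, hi2⟩ := le_min_iff.1 hi
    refine le_trans ?_ (card_grass_inf_le V hi1 hi2)
    rw [Nat.card_eq_fintype_card, Fintype.card_subtype]
    exact_mod_cast Finset.card_le_card
      (Finset.filter_subset_filter _ (Finset.subset_univ _))
  calc _ ≤ S := hS
    _ = gaussBinom (Fintype.card F) n δ * (S / gaussBinom (Fintype.card F) n δ) := by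
        field_simp
    _ ≤ _ := mul_le_mul_of_nonneg_right hG
        (div_nonneg ((Nat.cast_nonneg _).trans hS) hG0.le)

open Classical in
theorem card_acceptedGuesses_le {k : ℕ} {C : Submodule L (Fin n → L)} {dec : Decoder F L n δ}
    (hdec : IsErrorErasureDecoder k C dec) (w : ℕ) (r : Fin n → L) :
    (acceptedGuesses dec w r).card ≤ ∑ c : C,
      if rank F (r - (c : Fin n → L)) ≤ w then
        (goodGuesses k δ (rowSpace F (r - (c : Fin n → L)))).card else 0 := by
  have hsub : acceptedGuesses dec w r ⊆ Finset.univ.biUnion fun c : C =>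
      if rank F (r - (c : Fin n → L)) ≤ w then
        goodGuesses k δ (rowSpace F (r - (c : Fin n → L))) else ∅ := by
    intro U hU
    simp only [acceptedGuesses, Finset.mem_filter_univ, Option.isSome_iff_exists,
      Option.filter_eq_some_iff, decide_eq_true_eq] at hU
    obtain ⟨c, hc, hcw⟩ := hU
    obtain ⟨hcC, hrad⟩ := hdec _ _ _ hc
    refine Finset.mem_biUnion.2 ⟨⟨c, hcC⟩, Finset.mem_univ _, ?_⟩
    rw [if_pos hcw, goodGuesses, Finset.mem_filter_univ, finrank_rowSpace]
    rwa [span_range_basisMatrix] at hrad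
  refine (Finset.card_le_card hsub).trans (Finset.card_biUnion_le.trans (le_of_eq ?_))
  exact Finset.sum_congr rfl fun c _ => by split_ifs <;> simp

/-- The code has k generators; the union bound needs its size only from above. -/
theorem card_gabidulin_le (q k : ℕ) (g : Fin n → L) :
    Nat.card (gabidulin q k g) ≤ Fintype.card L ^ k := by
  rw [Module.natCard_eq_pow_finrank (K := L), Nat.card_eq_fintype_card]
  refine Nat.pow_le_pow_right Fintype.card_pos ?_
  exact (finrank_range_le_card _).trans (Fintype.card_fin k).le

open Classical in
theorem sum_card_goodGuesses_le (hδ : δ ≤ n) (k w : ℕ) :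
    ∑ e : Fin n → L, (if rank F e ≤ w then ((goodGuesses k δ (rowSpace F e)).card : ℝ) else 0) ≤
      Fintype.card (Grass F n δ) * ∑ j ∈ Finset.range (w + 1),
        (Nat.card {e : Fin n → L // rank F e = j} : ℝ) *
          guessProb (Fintype.card F) n k δ j := by
  rw [← Finset.sum_filter, ← Finset.sum_fiberwise_of_maps_to (t := Finset.range (w + 1))
    (g := fun e => rank F e) (fun e he => by simpa [Nat.lt_succ_iff] using he), Finset.mul_sum]
  refine Finset.sum_le_sum fun j _ => ?_
  have h : ∀ e ∈ (Finset.univ.filter fun e : Fin n → L => rank F e ≤ w).filter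
      fun e => rank F e = j, ((goodGuesses k δ (rowSpace F e)).card : ℝ) ≤
        Fintype.card (Grass F n δ) * guessProb (Fintype.card F) n k δ j := by
    intro e he
    rw [← (Finset.mem_filter.1 he).2, ← finrank_rowSpace]
    exact card_goodGuesses_le hδ k _
  refine (Finset.sum_le_card_nsmul _ _ _ h).trans ?_
  rw [nsmul_eq_mul, mul_left_comm]
  refine mul_le_mul_of_nonneg_left (mul_le_mul_of_nonneg_right ?_
    (guessProb_nonneg Fintype.one_lt_card _ _ _ _)) (Nat.cast_nonneg _)
  rw [Nat.card_eq_fintype_card, Fintype.card_subtype]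
  exact_mod_cast Finset.card_le_card (Finset.filter_subset_filter _ (Finset.subset_univ _))

theorem sum_acceptanceProb_le (hδ : δ ≤ n) {k : ℕ} {C : Submodule L (Fin n → L)}
    {dec : Decoder F L n δ} (hdec : IsErrorErasureDecoder k C dec) (w : ℕ) :
    ∑ r, acceptanceProb dec w r ≤ Nat.card C * ∑ j ∈ Finset.range (w + 1),
      (Nat.card {e : Fin n → L // rank F e = j} : ℝ) * guessProb (Fintype.card F) n k δ j := by
  classical
  have := grass_nonempty F hδ
  have hG : (0 : ℝ) < Fintype.card (Grass F n δ) := by exact_mod_cast Fintype.card_pos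
  simp_rw [acceptanceProb, ← Finset.sum_div]
  rw [div_le_iff₀ hG]
  calc ∑ r, ((acceptedGuesses dec w r).card : ℝ)
      ≤ ∑ r : Fin n → L, ∑ c : C, (if rank F (r - (c : Fin n → L)) ≤ w then
          ((goodGuesses k δ (rowSpace F (r - (c : Fin n → L)))).card : ℝ) else 0) :=
        Finset.sum_le_sum fun r _ => by exact_mod_cast card_acceptedGuesses_le hdec w r
    _ = ∑ c : C, ∑ e : Fin n → L,
          (if rank F e ≤ w then ((goodGuesses k δ (rowSpace F e)).card : ℝ) else 0) := by
        -- For fixed c, the map r ↦ r - c permutes the words, so the inner sum is independent of c.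
        rw [Finset.sum_comm]
        exact Finset.sum_congr rfl fun c _ => Equiv.sum_comp (Equiv.subRight (c : Fin n → L))
          fun e => if rank F e ≤ w then ((goodGuesses k δ (rowSpace F e)).card : ℝ) else 0
    _ = Nat.card C * ∑ e : Fin n → L,
          (if rank F e ≤ w then ((goodGuesses k δ (rowSpace F e)).card : ℝ) else 0) := by
        rw [Finset.sum_const, nsmul_eq_mul, Finset.card_univ, Nat.card_eq_fintype_card]
    _ ≤ _ := mul_le_mul_of_nonneg_left (sum_card_goodGuesses_le hδ k w) (Nat.cast_nonneg _)
    _ = _ := by ring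

theorem mean_acceptanceProb_le (hδ : δ ≤ n) {k w : ℕ} (g : Fin n → L)
    {dec : Decoder F L n δ}
    (hdec : IsErrorErasureDecoder k (gabidulin (Fintype.card F) k g) dec) :
    (∑ r, acceptanceProb dec w r) / Fintype.card (Fin n → L) ≤
      solutionRate (Fintype.card F) (Module.finrank F L) n k δ w := by
  have hR : (0 : ℝ) < Fintype.card (Fin n → L) := by exact_mod_cast Fintype.card_pos
  have hq0 : (0 : ℝ) < Fintype.card F := by exact_mod_cast Fintype.card_pos
  have hL : Fintype.card L = Fintype.card F ^ Module.finrank F L :=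
    Module.card_eq_pow_finrank
  have hP : ∀ j, 0 ≤ guessProb (Fintype.card F) n k δ j :=
    guessProb_nonneg Fintype.one_lt_card _ _ _
  rw [div_le_iff₀ hR]
  refine (sum_acceptanceProb_le hδ hdec w).trans ?_
  have hC : (Nat.card (gabidulin (Fintype.card F) k g) : ℝ) ≤
      (Fintype.card F : ℝ) ^ ((Module.finrank F L : ℤ) * ((k : ℤ) - (n : ℤ))) *
        Fintype.card (Fin n → L) := by
    refine le_trans (by exact_mod_cast card_gabidulin_le (Fintype.card F) k g :
      (Nat.card (gabidulin (Fintype.card F) k g) : ℝ) ≤ (Fintype.card L : ℝ) ^ k) (le_of_eq ?_)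
    rw [Fintype.card_fun, Fintype.card_fin, hL, Nat.cast_pow, Nat.cast_pow, Nat.cast_pow, ← pow_mul,
      ← pow_mul, ← zpow_natCast, ← zpow_natCast, ← zpow_add₀ hq0.ne']
    congr 1
    push_cast
    ring
  refine (mul_le_mul_of_nonneg_right hC (Finset.sum_nonneg fun j _ =>
    mul_nonneg (Nat.cast_nonneg _) (hP j))).trans ?_
  rw [mul_right_comm]
  refine mul_le_mul_of_nonneg_right ?_ hR.le
  rw [solutionRate, Finset.mul_sum]
  refine Finset.sum_le_sum fun j _ => ?_
  rw [avgCount, mul_assoc]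
  exact mul_le_mul_of_nonneg_left
    (mul_le_mul_of_nonneg_right (card_rank_eq_le n j) (hP j)) (by positivity)

end Guess

/-! ### The minimum over δ. -/

section WorkFactor

variable {q m n k w : ℕ}

theorem two_mul_excess_le_iff {δ : ℕ} :
    2 * excess n k w ≤ (δ : ℝ) ↔ 2 * w + k ≤ n + δ := by
  rw [← Nat.cast_le (α := ℝ), excess]
  push_cast
  constructor <;> intro h <;> linarith

theorem workFactor_le (hq : 2 ≤ q) (hnm : n ≤ m) (hwk : w ≤ n) {δ : ℕ}
    (h1 : 2 * excess n k w ≤ (δ : ℝ)) (h2 : δ + k ≤ n) :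
    workFactor q m n k w ≤ (n : ℝ) ^ 2 / solutionRate q m n k δ w := by
  refine csInf_le ⟨0, ?_⟩ ⟨δ, ⟨h1, h2⟩, rfl⟩
  rintro _ ⟨δ', -, rfl⟩
  exact div_nonneg (by positivity) (solutionRate_nonneg hq hnm hwk)

/-- The term j = 0 is already positive: its guess probability is 1. -/
theorem solutionRate_pos {δ : ℕ} (hq : 2 ≤ q) (hnm : n ≤ m) (hwk : w ≤ n) (hδ : δ + k ≤ n) :
    0 < solutionRate q m n k δ w := by
  have hq0 : (0 : ℝ) < q := by exact_mod_cast (by omega : 0 < q)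
  refine Finset.sum_pos' (fun j hj => ?_) ⟨0, by simp, ?_⟩
  · have hj := Finset.mem_range.1 hj
    exact mul_nonneg (avgCount_nonneg hq (by omega) (by omega)) (guessProb_nonneg hq _ _ _ _)
  · rw [guessProb, if_neg (by omega), mul_one, avgCount, Finset.prod_range_zero, mul_one]
    positivity

theorem workBound_le_workFactor (hq : 2 ≤ q) (hnm : n ≤ m)
    (hw0 : n < 2 * w + k) (hwk : w + k ≤ n) :
    workBound q m n k w ≤ workFactor q m n k w := by
  -- The value δ = n - k is admissible, so the infimum is not the default 0 of an empty set.
  refine le_csInf ⟨_, n - k, ⟨two_mul_excess_le_iff.2 (by omega), (by omega)⟩, rfl⟩ ?_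
  rintro _ ⟨δ, ⟨h1, h2⟩, rfl⟩
  exact workBound_le_div_solutionRate hq hnm hw0 hwk (two_mul_excess_le_iff.1 h1) h2
    (solutionRate_pos hq hnm (by omega) h2)

end WorkFactor

end RankMetric

end

theorem mainTheorem2 {F L : Type*} [Field F] [Fintype F] [Field L] [Fintype L] [Algebra F L]
    (q m n k w : ℕ) (hq : Fintype.card F = q) (hm : Module.finrank F L = m)
    (g : Fin n → L) (hg : LinearIndependent F g)
    (hw : ((n : ℝ) - k) / 2 < w) (hwk : w + k ≤ n) :
    RankMetric.workBound q m n k w ≤ RankMetric.workFactor q m n k w ∧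
    ∀ (δ : ℕ) (_ : 2 * RankMetric.excess n k w ≤ (δ : ℝ)) (hδ : δ + k ≤ n)
      (dec : RankMetric.Decoder F L n δ),
      RankMetric.IsErrorErasureDecoder k (RankMetric.gabidulin q k g) dec →
      ∀ N : ℕ, 1 ≤ N →
        ENNReal.ofReal (RankMetric.workFactor q m n k w) ≤
          RankMetric.averageOperations
            (RankMetric.randomizedDecoderOnRandomWord ((Nat.le_add_right δ k).trans hδ) dec w N) ∧
        ENNReal.ofReal (RankMetric.workBound q m n k w) ≤
          RankMetric.averageOperations
            (RankMetric.randomizedDecoderOnRandomWord ((Nat.le_add_right δ k).trans hδ) dec w N) := by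
  subst hq hm
  have hq2 : 2 ≤ Fintype.card F := Fintype.one_lt_card
  -- Independence of the locators gives n ≤ m, which keeps the factors q^m - q^i nonnegative.
  have hnm : n ≤ Module.finrank F L := by simpa using hg.fintype_card_le_finrank
  have hw0 : n < 2 * w + k := by
    have : (n : ℝ) < 2 * w + k := by linarith
    exact_mod_cast this
  have hbound := RankMetric.workBound_le_workFactor hq2 hnm hw0 hwk
  refine ⟨hbound, fun δ h1 hδ dec hdec N hN => ?_⟩
  have key := (ENNReal.ofReal_le_ofReal
    (RankMetric.workFactor_le hq2 hnm (by omega) h1 hδ)).trans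
      (RankMetric.ofReal_div_le_averageOperations (by omega)
        ((Nat.le_add_right δ k).trans hδ) dec w hN
        (RankMetric.solutionRate_nonneg hq2 hnm (by omega))
        (RankMetric.mean_acceptanceProb_le (by omega) g hdec))
  exact ⟨key, (ENNReal.ofReal_le_ofReal hbound).trans key⟩
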